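/- Let $T\in(0,\infty)$ and $p\in(1,\infty)$. Let $w:\mathbb R\to[0,\infty)$ be a Muckenhoupt $A_p$-weight, that is, $w$ is measurable, positive almost everywhere, and $$[w]_{A_p}:=\sup_{a<b}\Big(\frac1{b-a}\int_a^b w(t)\,dt\Big)\Big(\frac1{b-a}\int_a^b w(t)^{-\frac1{p-1}}\,dt\Big)^{p-1}<\infty .$$ Put $W(t):=\int_0^t w(s)\,ds$. Let $X_0,X_1$ be Banach spaces that are continuously embedded in a common Hausdorff topological vector space, and assume that $X_0$ is continuously embedded into $X_1$, i.e. $X_0\subset X_1$ and there is a constant $N_{X_0,X_1}>0$ with $\|a\|_{X_1}\le N_{X_0,X_1}\|a\|_{X_0}$ for all $a\in X_0$. Let $u\in L_p((0,T),w\,dt;X_0)$, $f\in L_p((0,T),w\,dt;X_1)$ and $u_0\in X_0+X_1$ satisfy $$u(t)=u_0+\int_0^t f(s)\,ds\qquad\text{for all }t\in(0,T).$$ Then $u_0\in (X_0,X_1)_{W^{1/p},p}$ and $$\|u_0\|_{(X_0,X_1)_{W^{1/p},p}}\le C\,\big(\|u\|_{L_p((0,T),w\,dt;X_0)}+\|f\|_{L_p((0,T),w\,dt;X_1)}\big),$$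 where $C$ depends only on $p$, $N_{X_0,X_1}$, $T$ and an upper bound for $[w]_{A_p}$. Here, for $\phi:(0,\infty)\to(0,\infty)$, the space $(X_0,X_1)_{\phi,p}$ consists of all $a\in X_0+X_1$ for which $$\|a\|_{(X_0,X_1)_{\phi,p}}:=\Big(\int_0^\infty\big(\phi(t^{-1})\,K(t,a)\big)^p\,\frac{dt}{t}\Big)^{1/p}<\infty,$$ $$K(t,a):=\inf\{\|a_0\|_{X_0}+t\|a_1\|_{X_1}:\ a=a_0+a_1,\ a_0\in X_0,\ a_1\in X_1\},$$ and $\|g\|_{L_p((0,T),w\,dt;X)}:=\big(\int_0^T\|g(t)\|_X^p\,w(t)\,dt\big)^{1/p}$ for (strongly) measurable $g$. -/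

import Mathlib

open MeasureTheory Set
open scoped NNReal ENNReal

namespace WeightedTrace

/-- An interpolation couple `(X₀, X₁)`: two Banach spaces, both continuously embedded (by injective
continuous linear maps) in one Hausdorff topological vector space `Z`. -/
structure InterpolationCouple (X₀ X₁ Z : Type*)
    [NormedAddCommGroup X₀] [NormedSpace ℝ X₀] [CompleteSpace X₀]
    [NormedAddCommGroup X₁] [NormedSpace ℝ X₁] [CompleteSpace X₁]
    [AddCommGroup Z] [Module ℝ Z] [TopologicalSpace Z] [IsTopologicalAddGroup Z]
    [ContinuousSMul ℝ Z] [T2Space Z] where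
  incl₀ : X₀ →L[ℝ] Z
  incl₁ : X₁ →L[ℝ] Z
  incl₀_injective : Function.Injective incl₀
  incl₁_injective : Function.Injective incl₁

namespace InterpolationCouple

variable {X₀ X₁ Z : Type*}
  [NormedAddCommGroup X₀] [NormedSpace ℝ X₀] [CompleteSpace X₀]
  [NormedAddCommGroup X₁] [NormedSpace ℝ X₁] [CompleteSpace X₁]
  [AddCommGroup Z] [Module ℝ Z] [TopologicalSpace Z] [IsTopologicalAddGroup Z]
  [ContinuousSMul ℝ Z] [T2Space Z]

/-- `X₀` is continuously embedded into `X₁` (as subspaces of `Z`) with embedding constant `N`: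
every `a ∈ X₀` lies in `X₁`, and `‖a‖_{X₁} ≤ N ‖a‖_{X₀}`. -/
def EmbedsWith (c : InterpolationCouple X₀ X₁ Z) (N : ℝ) : Prop :=
  ∀ a : X₀, ∃ b : X₁, c.incl₁ b = c.incl₀ a ∧ ‖b‖ ≤ N * ‖a‖

/-- The sum `X₀ + X₁`, a subspace of `Z`. -/
def sumSpace (c : InterpolationCouple X₀ X₁ Z) : Set Z :=
  {a | ∃ (a₀ : X₀) (a₁ : X₁), a = c.incl₀ a₀ + c.incl₁ a₁}

/-- The functional `K(t, a; X₀, X₁) = inf {‖a₀‖ + t ‖a₁‖ : a = a₀ + a₁}` (for `t > 0`); it is finite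
exactly for `a ∈ X₀ + X₁`. -/
noncomputable def K (c : InterpolationCouple X₀ X₁ Z) (t : ℝ) (a : Z) : ℝ≥0∞ :=
  ⨅ (a₀ : X₀) (a₁ : X₁) (_ : a = c.incl₀ a₀ + c.incl₁ a₁), ‖a₀‖ₑ + ENNReal.ofReal t * ‖a₁‖ₑ

/-- The norm `(∫₀^∞ (φ(1/t) K(t, a; X₀, X₁))^p dt/t)^{1/p}` of the generalized real interpolation
space `(X₀, X₁)_{φ,p}`, as an extended nonnegative number. -/
noncomputable def interpNorm (c : InterpolationCouple X₀ X₁ Z) (φ : ℝ → ℝ) (p : ℝ) (a : Z) :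
    ℝ≥0∞ :=
  (∫⁻ t in Ioi (0 : ℝ),
    (ENNReal.ofReal (φ t⁻¹) * c.K t a) ^ p * ENNReal.ofReal t⁻¹) ^ (1 / p)

/-- The generalized real interpolation space `(X₀, X₁)_{φ,p}` (by the `K`-method). -/
def interpSpace (c : InterpolationCouple X₀ X₁ Z) (φ : ℝ → ℝ) (p : ℝ) : Set Z :=
  {a | a ∈ c.sumSpace ∧ c.interpNorm φ p a < ∞}

end InterpolationCouple

/-- The Muckenhoupt constant `[w]_{A_p}`: the supremum over all compact intervals `[a, b]` of
`(⨍ w) (⨍ w^{-1/(p-1)})^{p-1}`. Here `0 ^ (-1/(p-1)) = ∞`. -/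
noncomputable def apConst (p : ℝ) (w : ℝ → ℝ≥0) : ℝ≥0∞ :=
  ⨆ (a : ℝ) (b : ℝ) (_ : a < b),
    ((ENNReal.ofReal (b - a))⁻¹ * ∫⁻ t in Icc a b, (w t : ℝ≥0∞)) *
      ((ENNReal.ofReal (b - a))⁻¹ * ∫⁻ t in Icc a b, (w t : ℝ≥0∞) ^ (-(1 / (p - 1)))) ^ (p - 1)

/-- Muckenhoupt's class `A_p = A_p(ℝ)`. When `apConst p w` is finite, `w` is either positive almost
everywhere or zero almost everywhere (because `0 * ∞ = 0` in `ℝ≥0∞`); positivity excludes the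
latter, degenerate case. -/
structure IsApWeight (p : ℝ) (w : ℝ → ℝ≥0) : Prop where
  aemeasurable : AEMeasurable w volume
  pos : ∀ᵐ t ∂volume, 0 < w t
  apConst_lt_top : apConst p w < ∞

/-- The measure `w(t) dt` on `(0, T)`. -/
noncomputable def weightMeasure (T : ℝ) (w : ℝ → ℝ≥0) : Measure ℝ :=
  (volume.restrict (Ioo 0 T)).withDensity fun t => (w t : ℝ≥0∞)

/-- `W(t) = ∫₀ᵗ w(s) ds`. -/
noncomputable def primitive (w : ℝ → ℝ≥0) (t : ℝ) : ℝ :=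
  ∫ s in (0 : ℝ)..t, (w s : ℝ)

end WeightedTrace

/-! Every `τ` in `(0, T)` gives the decomposition `u₀ = u τ - ∫₀^τ f`. Averaging the resulting bound
on `K` over `0 < τ < 1/t` shows that `K(t, u₀)` is at most the mean of a multiple of `‖u‖ + ‖f‖`
over `(0, 1/t)`; for `1/t > T` the whole of `u₀` is put in `X₁`, using the embedding
(`K_initial_value_le`).

The claim thus reduces to a Hardy inequality with outer weight `W(1/t) dt/t` (`exists_hardy_le`).
Let `σ = w ^ (-1/(p-1))`. The `A_p` condition makes `∫₀^r σ` reverse doubling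
(`exists_reverse_doubling`), so for small `b > 0` a dyadic sum bounds `∫₀^r s^(-b) σ` by a multiple
of `r^(-b) ∫₀^r σ` (`lintegral_rpow_mul_le`). Hölder with weight `s^c w`, `c = b (p - 1)`, and the
`A_p` bound on `(0, r]` leave a positive power of `t`, and Tonelli finishes. -/

namespace WeightedTrace

/-! ### Weighted Hölder inequality and the `A_p` condition on `(0, r]`. -/

/-- Hölder's inequality with a weight, in the form used for Muckenhoupt weights. -/
theorem rpow_lintegral_le_weighted {p : ℝ} (hp : 1 < p) {ν : Measure ℝ} {g m : ℝ → ℝ≥0∞}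
    (hg : AEMeasurable g ν) (hm : AEMeasurable m ν) (hpos : ∀ᵐ s ∂ν, m s ≠ 0)
    (hfin : ∀ᵐ s ∂ν, m s ≠ ∞) :
    (∫⁻ s, g s ∂ν) ^ p ≤
      (∫⁻ s, g s ^ p * m s ∂ν) * (∫⁻ s, m s ^ (-(1 / (p - 1))) ∂ν) ^ (p - 1) := by
  have hp0 : 0 < p := by linarith
  have hp1 : 0 < p - 1 := by linarith
  have hpq : p.HolderConjugate (p / (p - 1)) := Real.HolderConjugate.conjExponent hp
  -- Factor `g = (g m^(1/p)) · m^(-1/p)`, valid where `m` is neither zero nor infinite.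
  have key := ENNReal.lintegral_mul_le_Lp_mul_Lq ν hpq
    (hg.mul (hm.pow_const (1 / p))) (hm.pow_const (-(1 / p)))
  have e1 : ∫⁻ s, g s ∂ν =
      ∫⁻ s, ((g * fun s => m s ^ (1 / p)) * fun s => m s ^ (-(1 / p))) s ∂ν := by
    refine lintegral_congr_ae ?_
    filter_upwards [hpos, hfin] with s h0 h1
    simp only [Pi.mul_apply]
    rw [mul_assoc, ← ENNReal.rpow_add _ _ h0 h1]
    simp
  have e2 : ∀ s, (g * fun s => m s ^ (1 / p)) s ^ p = g s ^ p * m s := by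
    intro s
    simp only [Pi.mul_apply]
    rw [ENNReal.mul_rpow_of_nonneg _ _ hp0.le, ← ENNReal.rpow_mul, one_div_mul_cancel hp0.ne',
      ENNReal.rpow_one]
  have e3 : ∀ s, (m s ^ (-(1 / p))) ^ (p / (p - 1)) = m s ^ (-(1 / (p - 1))) := by
    intro s
    rw [← ENNReal.rpow_mul]
    congr 1
    field_simp
  simp only [e2, e3] at key
  rw [e1]
  calc _ ≤ ((∫⁻ s, g s ^ p * m s ∂ν) ^ (1 / p) *
        (∫⁻ s, m s ^ (-(1 / (p - 1))) ∂ν) ^ (1 / (p / (p - 1)))) ^ p :=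
        ENNReal.rpow_le_rpow key hp0.le
    _ = _ := by
        rw [ENNReal.mul_rpow_of_nonneg _ _ hp0.le, ← ENNReal.rpow_mul, ← ENNReal.rpow_mul,
          one_div_mul_cancel hp0.ne', ENNReal.rpow_one]
        congr 2
        field_simp

/-- The weight `w ^ (-1 / (p - 1))` dual to `w`. -/
noncomputable def dualWeight (p : ℝ) (w : ℝ → ℝ≥0) (t : ℝ) : ℝ≥0∞ :=
  (w t : ℝ≥0∞) ^ (-(1 / (p - 1)))

theorem lintegral_mul_lintegral_dualWeight_le {p : ℝ} (hp : 1 < p) {w : ℝ → ℝ≥0} {A : ℝ≥0}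
    (hA : apConst p w ≤ A) {r : ℝ} (hr : 0 < r) :
    (∫⁻ t in Ioc 0 r, (w t : ℝ≥0∞)) * (∫⁻ t in Ioc 0 r, dualWeight p w t) ^ (p - 1) ≤
      A * ENNReal.ofReal r ^ p := by
  have hp1 : 0 < p - 1 := by linarith
  have h : _ ≤ apConst p w := le_iSup_of_le (0 : ℝ) (le_iSup_of_le r (le_iSup_of_le hr le_rfl))
  replace h := h.trans hA
  rw [← restrict_Ioc_eq_restrict_Icc, sub_zero, ENNReal.mul_rpow_of_nonneg _ _ hp1.le] at h
  have hR0 : ENNReal.ofReal r ≠ 0 := by simpa using hr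
  have hRt : ENNReal.ofReal r ≠ ∞ := ENNReal.ofReal_ne_top
  set R := ENNReal.ofReal r
  have e : R⁻¹ * R⁻¹ ^ (p - 1) = (R ^ p)⁻¹ := by
    rw [← ENNReal.inv_rpow]
    nth_rewrite 1 [← ENNReal.rpow_one R⁻¹]
    rw [← ENNReal.rpow_add _ _ (by simpa using hRt) (by simpa using hR0)]
    congr 1; ring
  rw [mul_mul_mul_comm, e] at h
  rwa [← ENNReal.div_le_iff (by simp [ENNReal.rpow_eq_zero_iff, hR0, hRt])
    (by simp [ENNReal.rpow_eq_top_iff, hR0, hRt]), ENNReal.div_eq_inv_mul]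

theorem IsApWeight.aemeasurable_coe {p : ℝ} {w : ℝ → ℝ≥0} (hw : IsApWeight p w) :
    AEMeasurable (fun t => (w t : ℝ≥0∞)) volume :=
  hw.aemeasurable.coe_nnreal_ennreal

theorem IsApWeight.aemeasurable_dualWeight {p : ℝ} {w : ℝ → ℝ≥0} (hw : IsApWeight p w) :
    AEMeasurable (dualWeight p w) volume :=
  hw.aemeasurable.coe_nnreal_ennreal.pow_const _

theorem lintegral_Ioc_ne_zero {g : ℝ → ℝ≥0∞} (hg : AEMeasurable g volume)
    (hpos : ∀ᵐ t ∂volume, g t ≠ 0) {a b : ℝ} (hab : a < b) : ∫⁻ t in Ioc a b, g t ≠ 0 := by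
  intro h
  rw [lintegral_eq_zero_iff' hg.restrict] at h
  have h2 : ∀ᵐ t ∂(volume.restrict (Ioc a b)), False := by
    filter_upwards [h, ae_restrict_of_ae hpos] with t h1 h2 using h2 h1
  rw [Filter.eventually_false_iff_eq_bot, ae_eq_bot, Measure.restrict_eq_zero] at h2
  simp at h2
  linarith

theorem dualWeight_ne_zero {p : ℝ} (hp : 1 < p) (w : ℝ → ℝ≥0) (t : ℝ) :
    dualWeight p w t ≠ 0 := by
  have : 0 < 1 / (p - 1) := one_div_pos.2 (by linarith)
  simp [dualWeight, ENNReal.rpow_eq_zero_iff, this.le, -one_div]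

theorem IsApWeight.coe_ne_zero {p : ℝ} {w : ℝ → ℝ≥0} (hw : IsApWeight p w) :
    ∀ᵐ t ∂volume, (w t : ℝ≥0∞) ≠ 0 := by
  filter_upwards [hw.pos] with t ht
  simpa using ht.ne'

/-- The `A_p` product is finite and its other factor, the integral of `w`, is nonzero. -/
theorem IsApWeight.lintegral_dualWeight_lt_top {p : ℝ} (hp : 1 < p) {w : ℝ → ℝ≥0}
    (hw : IsApWeight p w) {A : ℝ≥0} (hA : apConst p w ≤ A) {r : ℝ} (hr : 0 < r) :
    ∫⁻ t in Ioc 0 r, dualWeight p w t < ∞ := by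
  have h := (lintegral_mul_lintegral_dualWeight_le hp hA hr).trans_lt
    (ENNReal.mul_lt_top ENNReal.coe_lt_top
      (ENNReal.rpow_lt_top_of_nonneg (by linarith) ENNReal.ofReal_ne_top))
  have h2 := ENNReal.lt_top_of_mul_ne_top_right h.ne
    (lintegral_Ioc_ne_zero hw.aemeasurable_coe hw.coe_ne_zero hr)
  by_contra h3
  rw [not_lt_top_iff.1 h3, ENNReal.top_rpow_of_pos (by linarith)] at h2
  simp at h2

theorem IsApWeight.lintegral_lt_top {p : ℝ} (hp : 1 < p) {w : ℝ → ℝ≥0}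
    (hw : IsApWeight p w) {A : ℝ≥0} (hA : apConst p w ≤ A) {r : ℝ} (hr : 0 < r) :
    ∫⁻ t in Ioc 0 r, (w t : ℝ≥0∞) < ∞ := by
  have h := (lintegral_mul_lintegral_dualWeight_le hp hA hr).trans_lt
    (ENNReal.mul_lt_top ENNReal.coe_lt_top
      (ENNReal.rpow_lt_top_of_nonneg (by linarith) ENNReal.ofReal_ne_top))
  refine ENNReal.lt_top_of_mul_ne_top_left h.ne fun h0 => ?_
  rw [ENNReal.rpow_eq_zero_iff_of_pos (by linarith)] at h0
  exact lintegral_Ioc_ne_zero hw.aemeasurable_dualWeight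
    (Filter.Eventually.of_forall (dualWeight_ne_zero hp w)) hr h0

/-! ### Reverse doubling at the origin and dyadic summation. -/

/-- The dual weight of an `A_p`-weight satisfies a reverse doubling condition at the origin. -/
theorem exists_reverse_doubling {p : ℝ} (hp : 1 < p) (A : ℝ≥0) :
    ∃ θ : ℝ, 0 < θ ∧ θ < 1 ∧ ∀ w : ℝ → ℝ≥0, IsApWeight p w → apConst p w ≤ A →
      ∀ r : ℝ, 0 < r → ∫⁻ t in Ioc 0 (r / 2), dualWeight p w t ≤
        ENNReal.ofReal θ * ∫⁻ t in Ioc 0 r, dualWeight p w t := by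
  have hp1 : 0 < p - 1 := by linarith
  have hp0 : 0 < p := by linarith
  -- `D` will bound the ratio of the dual mass of `(0, r]` to that of `(r/2, r]`; `D ≥ 2` keeps `θ =
  -- 1 - 1/D` strictly positive.
  obtain ⟨D, hD2, hDA⟩ : ∃ D : ℝ, 2 ≤ D ∧ (A * 2 ^ p : ℝ) ≤ D ^ (p - 1) := by
    refine ⟨max 2 ((A * 2 ^ p : ℝ) ^ (1 / (p - 1))), le_max_left _ _, ?_⟩
    calc (A * 2 ^ p : ℝ) = ((A * 2 ^ p : ℝ) ^ (1 / (p - 1))) ^ (p - 1) := by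
          rw [← Real.rpow_mul (by positivity), one_div_mul_cancel hp1.ne', Real.rpow_one]
      _ ≤ _ := Real.rpow_le_rpow (by positivity) (le_max_right _ _) hp1.le
  have hD0 : 0 < D := by linarith
  refine ⟨1 - D⁻¹, ?_, ?_, ?_⟩
  · have : D⁻¹ < 1 := inv_lt_one_of_one_lt₀ (by linarith)
    linarith
  · have : 0 < D⁻¹ := by positivity
    linarith
  intro w hw hA r hr
  have hsplit : ∫⁻ t in Ioc 0 r, dualWeight p w t =
      (∫⁻ t in Ioc 0 (r / 2), dualWeight p w t) + ∫⁻ t in Ioc (r / 2) r, dualWeight p w t := by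
    rw [← lintegral_union measurableSet_Ioc (Ioc_disjoint_Ioc_of_le le_rfl),
      Ioc_union_Ioc_eq_Ioc (by linarith) (by linarith)]
  have hSfin := hw.lintegral_dualWeight_lt_top hp hA hr
  have hWfin := hw.lintegral_lt_top hp hA hr
  have hW0 := lintegral_Ioc_ne_zero hw.aemeasurable_coe hw.coe_ne_zero hr
  have hAp := lintegral_mul_lintegral_dualWeight_le hp hA hr
  -- Hölder applied to the constant `1` bounds the dual mass of the outer half from below.
  have hHol := rpow_lintegral_le_weighted hp (ν := volume.restrict (Ioc (r / 2) r))
    (g := fun _ => 1) aemeasurable_const hw.aemeasurable_coe.restrict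
    (ae_restrict_of_ae hw.coe_ne_zero) (Filter.Eventually.of_forall fun _ => ENNReal.coe_ne_top)
  have hmono : ∫⁻ t in Ioc (r / 2) r, (w t : ℝ≥0∞) ≤ ∫⁻ t in Ioc 0 r, (w t : ℝ≥0∞) :=
    lintegral_mono_set (Ioc_subset_Ioc_left (by linarith))
  simp only [ENNReal.one_rpow, one_mul, lintegral_const, Measure.restrict_apply_univ,
    Real.volume_Ioc] at hHol
  change _ ≤ _ * (∫⁻ t in Ioc (r / 2) r, dualWeight p w t) ^ (p - 1) at hHol
  set S := ∫⁻ t in Ioc 0 r, dualWeight p w t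
  set S' := ∫⁻ t in Ioc 0 (r / 2), dualWeight p w t
  set E := ∫⁻ t in Ioc (r / 2) r, dualWeight p w t
  set W := ∫⁻ t in Ioc 0 r, (w t : ℝ≥0∞)
  have hr2 : ENNReal.ofReal r = 2 * ENNReal.ofReal (r - r / 2) := by
    rw [show (2 : ℝ≥0∞) = ENNReal.ofReal 2 by simp, ← ENNReal.ofReal_mul (by norm_num)]
    congr 1; ring
  have hDA' : (A : ℝ≥0∞) * 2 ^ p ≤ ENNReal.ofReal D ^ (p - 1) := by
    rw [ENNReal.ofReal_rpow_of_pos hD0]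
    have : (A : ℝ≥0∞) * 2 ^ p = ENNReal.ofReal (A * 2 ^ p) := by
      rw [ENNReal.ofReal_mul (by positivity), ENNReal.ofReal_coe_nnreal,
        ← ENNReal.ofReal_rpow_of_pos (by norm_num)]
      simp
    rw [this]
    exact ENNReal.ofReal_le_ofReal hDA
  -- Compare `p - 1` powers after multiplying by `W`, which is nonzero and finite and so cancels.
  have hSE : S ≤ ENNReal.ofReal D * E := by
    rw [← ENNReal.rpow_le_rpow_iff hp1, ENNReal.mul_rpow_of_nonneg _ _ hp1.le,
      ← ENNReal.mul_le_mul_iff_right hW0 hWfin.ne]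
    calc W * S ^ (p - 1) ≤ A * ENNReal.ofReal r ^ p := hAp
      _ = (A * 2 ^ p) * ENNReal.ofReal (r - r / 2) ^ p := by
        rw [hr2, ENNReal.mul_rpow_of_nonneg _ _ hp0.le, mul_assoc]
      _ ≤ ENNReal.ofReal D ^ (p - 1) * (W * E ^ (p - 1)) := by
        gcongr
        exact hHol.trans (by gcongr)
      _ = _ := by ring
  have hS' : S' ≠ ∞ := ne_top_of_le_ne_top hSfin.ne (by rw [hsplit]; exact le_self_add)
  have hE : E ≠ ∞ := ne_top_of_le_ne_top hSfin.ne (by rw [hsplit]; exact le_add_self)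
  clear_value S S' E
  lift S' to ℝ≥0 using hS'
  lift E to ℝ≥0 using hE
  lift D to ℝ≥0 using hD0.le
  subst hsplit
  rw [ENNReal.ofReal_coe_nnreal] at hSE
  norm_cast at hSE
  rw [← NNReal.coe_le_coe] at hSE
  push_cast at hSE
  rw [← ENNReal.ofReal_coe_nnreal, ← ENNReal.ofReal_coe_nnreal,
    ← ENNReal.ofReal_add (by positivity) (by positivity), ← ENNReal.ofReal_mul]
  · apply ENNReal.ofReal_le_ofReal
    -- With `S = S' + E`, this rearranges to `S' + E ≤ D * E`.
    have : (D : ℝ) * S' ≤ D * ((1 - (D : ℝ)⁻¹) * (S' + E)) := by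
      rw [← mul_assoc, mul_sub, mul_inv_cancel₀ hD0.ne']
      linarith
    exact le_of_mul_le_mul_left this hD0
  · have : (D : ℝ)⁻¹ < 1 := inv_lt_one_of_one_lt₀ (by linarith)
    linarith

/-- Integrals of `s ^ (-b) g(s)` over `(0, r]` when `g` is reverse doubling at the origin. -/
theorem lintegral_rpow_mul_le {g : ℝ → ℝ≥0∞} {θ b : ℝ} (hb : 0 ≤ b)
    (hg : ∀ r : ℝ, 0 < r → ∫⁻ t in Ioc 0 (r / 2), g t ≤
      ENNReal.ofReal θ * ∫⁻ t in Ioc 0 r, g t) {r : ℝ} (hr : 0 < r) :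
    ∫⁻ s in Ioc 0 r, ENNReal.ofReal (s ^ (-b)) * g s ≤
      ENNReal.ofReal (2 ^ b) * (1 - ENNReal.ofReal (2 ^ b * θ))⁻¹ * ENNReal.ofReal (r ^ (-b)) *
        ∫⁻ s in Ioc 0 r, g s := by
  have hiter : ∀ j : ℕ, ∫⁻ t in Ioc 0 (r / 2 ^ j), g t ≤
      ENNReal.ofReal θ ^ j * ∫⁻ t in Ioc 0 r, g t := by
    intro j
    induction j with
    | zero => simp
    | succ k ih =>
      have := hg (r / 2 ^ k) (by positivity)
      rw [div_div, ← pow_succ] at this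
      calc _ ≤ _ := this
        _ ≤ ENNReal.ofReal θ * (ENNReal.ofReal θ ^ k * ∫⁻ t in Ioc 0 r, g t) := by gcongr
        _ = _ := by ring
  have hcover : Ioc 0 r ⊆ ⋃ j : ℕ, Ioc (r / 2 ^ (j + 1)) (r / 2 ^ j) := by
    intro s hs
    obtain ⟨j, h1, h2⟩ := exists_nat_pow_near (x := r / s) (y := (2 : ℝ))
      ((one_le_div hs.1).2 hs.2) (by norm_num)
    refine mem_iUnion.2 ⟨j, ?_, ?_⟩
    · rw [div_lt_iff₀ (by positivity)]
      rw [div_lt_iff₀ hs.1] at h2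
      linarith
    · rw [le_div_iff₀ (by positivity)]
      rw [le_div_iff₀ hs.1] at h1
      linarith
  -- On the `j`-th dyadic piece `s^(-b)` grows by `2^b` per step while the mass of `g` decays by
  -- `θ`: a geometric series of ratio `2^b θ`.
  have hpiece : ∀ j : ℕ, ∫⁻ s in Ioc (r / 2 ^ (j + 1)) (r / 2 ^ j),
      ENNReal.ofReal (s ^ (-b)) * g s ≤
      (ENNReal.ofReal (2 ^ b) * ENNReal.ofReal (r ^ (-b)) * ∫⁻ s in Ioc 0 r, g s) *
        ENNReal.ofReal (2 ^ b * θ) ^ j := by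
    intro j
    have hpt : ∀ s ∈ Ioc (r / 2 ^ (j + 1)) (r / 2 ^ j), ENNReal.ofReal (s ^ (-b)) * g s ≤
        ENNReal.ofReal ((r / 2 ^ (j + 1)) ^ (-b)) * g s := by
      intro s hs
      gcongr ENNReal.ofReal ?_ * _
      exact Real.rpow_le_rpow_of_nonpos (by positivity) hs.1.le (by linarith)
    have hval : (r / 2 ^ (j + 1)) ^ (-b) = 2 ^ b * r ^ (-b) * (2 ^ b) ^ j := by
      rw [Real.div_rpow hr.le (by positivity), Real.rpow_neg (x := 2 ^ (j + 1)) (by positivity),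
        div_inv_eq_mul, ← Real.rpow_natCast, ← Real.rpow_mul (by norm_num), mul_comm _ b,
        Real.rpow_mul (by norm_num), Real.rpow_natCast, pow_succ]
      ring
    calc _ ≤ ∫⁻ s in Ioc (r / 2 ^ (j + 1)) (r / 2 ^ j),
          ENNReal.ofReal ((r / 2 ^ (j + 1)) ^ (-b)) * g s :=
          setLIntegral_mono' measurableSet_Ioc hpt
      _ = ENNReal.ofReal ((r / 2 ^ (j + 1)) ^ (-b)) *
          ∫⁻ s in Ioc (r / 2 ^ (j + 1)) (r / 2 ^ j), g s :=
          lintegral_const_mul' _ _ ENNReal.ofReal_ne_top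
      _ ≤ ENNReal.ofReal ((r / 2 ^ (j + 1)) ^ (-b)) *
          (ENNReal.ofReal θ ^ j * ∫⁻ t in Ioc 0 r, g t) := by
          gcongr
          exact (lintegral_mono_set (Ioc_subset_Ioc_left (by positivity))).trans (hiter j)
      _ = _ := by
          rw [hval, ENNReal.ofReal_mul (by positivity), ENNReal.ofReal_mul (by positivity),
            ENNReal.ofReal_mul (by positivity), mul_pow, ENNReal.ofReal_pow (by positivity)]
          ring
  calc _ ≤ ∫⁻ s in ⋃ j : ℕ, Ioc (r / 2 ^ (j + 1)) (r / 2 ^ j), ENNReal.ofReal (s ^ (-b)) * g s :=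
        lintegral_mono_set hcover
    _ ≤ _ := lintegral_iUnion_le _ _
    _ ≤ _ := ENNReal.tsum_le_tsum hpiece
    _ = _ := by
        rw [ENNReal.tsum_mul_left, ENNReal.tsum_geometric]
        ring

/-! ### The weighted Hardy inequality. -/

theorem lintegral_Ioc_rpow {c r : ℝ} (hc : 0 < c) (hr : 0 ≤ r) :
    ∫⁻ t in Ioc 0 r, ENNReal.ofReal (t ^ (c - 1)) = ENNReal.ofReal (r ^ c / c) := by
  rw [← ofReal_integral_eq_lintegral_ofReal]
  · rw [← intervalIntegral.integral_of_le hr, integral_rpow (Or.inl (by linarith))]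
    simp [Real.zero_rpow hc.ne']
  · exact (intervalIntegrable_iff_integrableOn_Ioc_of_le hr).1
      (intervalIntegral.intervalIntegrable_rpow' (by linarith))
  · filter_upwards [ae_restrict_mem measurableSet_Ioc] with t ht
    exact Real.rpow_nonneg ht.1.le _

/-- Tonelli: for positive `s`, `t` the region `s ≤ 1/t` is also `t ≤ 1/s`. -/
theorem lintegral_rpow_mul_lintegral_Ioc_inv {c : ℝ} (hc : 0 < c) {H : ℝ → ℝ≥0∞}
    (hH : AEMeasurable H volume) :
    ∫⁻ t in Ioi (0 : ℝ), ENNReal.ofReal (t ^ (c - 1)) * ∫⁻ s in Ioc 0 t⁻¹, H s =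
      ∫⁻ s in Ioi (0 : ℝ), ENNReal.ofReal (s⁻¹ ^ c / c) * H s := by
  have hset : MeasurableSet {q : ℝ × ℝ | q.2 ≤ q.1⁻¹} :=
    measurableSet_le measurable_snd measurable_fst.inv
  set k : ℝ → ℝ → ℝ≥0∞ := fun t s =>
    {q : ℝ × ℝ | q.2 ≤ q.1⁻¹}.indicator (fun q => ENNReal.ofReal (q.1 ^ (c - 1)) * H q.2) (t, s)
    with hk
  have hmeas : AEMeasurable (Function.uncurry k)
      ((volume.restrict (Ioi (0 : ℝ))).prod (volume.restrict (Ioi (0 : ℝ)))) := by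
    refine AEMeasurable.indicator (AEMeasurable.mul ?_ hH.restrict.comp_snd) hset
    fun_prop
  have h1 : ∀ t ∈ Ioi (0 : ℝ), ENNReal.ofReal (t ^ (c - 1)) * ∫⁻ s in Ioc 0 t⁻¹, H s =
      ∫⁻ s in Ioi (0 : ℝ), k t s := by
    intro t _
    rw [← lintegral_const_mul' _ _ ENNReal.ofReal_ne_top, ← Ioi_inter_Iic, inter_comm,
      ← Measure.restrict_restrict measurableSet_Iic, ← lintegral_indicator measurableSet_Iic]
    rfl
  have h2 : ∀ s ∈ Ioi (0 : ℝ), ∫⁻ t in Ioi (0 : ℝ), k t s =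
      ENNReal.ofReal (s⁻¹ ^ c / c) * H s := by
    intro s hs
    rw [← lintegral_Ioc_rpow hc (inv_nonneg.2 (le_of_lt hs)),
      ← lintegral_mul_const _ (by fun_prop), ← Ioi_inter_Iic, inter_comm,
      ← Measure.restrict_restrict measurableSet_Iic, ← lintegral_indicator measurableSet_Iic]
    refine setLIntegral_congr_fun measurableSet_Ioi fun t ht => ?_
    have : s ≤ t⁻¹ ↔ t ≤ s⁻¹ := le_inv_comm₀ hs ht
    simp [hk, indicator, this]
  rw [setLIntegral_congr_fun measurableSet_Ioi h1, lintegral_lintegral_swap hmeas,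
    setLIntegral_congr_fun measurableSet_Ioi h2]

/-- A Hardy inequality for `A_p`-weights. -/
theorem exists_hardy_le {p : ℝ} (hp : 1 < p) (A : ℝ≥0) :
    ∃ C : ℝ≥0, ∀ w : ℝ → ℝ≥0, IsApWeight p w → apConst p w ≤ A →
      ∀ G : ℝ → ℝ≥0∞, AEMeasurable G volume →
        ∫⁻ t in Ioi (0 : ℝ), ((∫⁻ s in Ioc 0 t⁻¹, (w s : ℝ≥0∞)) *
          (ENNReal.ofReal t * ∫⁻ s in Ioc 0 t⁻¹, G s) ^ p) * ENNReal.ofReal t⁻¹ ≤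
        C * ∫⁻ s in Ioi (0 : ℝ), G s ^ p * w s := by
  obtain ⟨θ, hθ0, hθ1, hθ⟩ := exists_reverse_doubling hp A
  have hp1 : 0 < p - 1 := by linarith
  have hp0 : 0 < p := by linarith
  obtain ⟨b, hb, hbθ⟩ : ∃ b : ℝ, 0 < b ∧ 2 ^ b * θ < 1 := by
    -- This choice makes `2^b = θ^(-1/2)`, hence `2^b θ = θ^(1/2) < 1`.
    refine ⟨-(Real.logb 2 θ) / 2, ?_, ?_⟩
    · have := Real.logb_neg (b := 2) (by norm_num) hθ0 hθ1
      linarith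
    · have h : (2 : ℝ) ^ (-(Real.logb 2 θ) / 2) = θ ^ (-(1 / 2) : ℝ) := by
        rw [show -(Real.logb 2 θ) / 2 = Real.logb 2 θ * (-(1 / 2)) by ring,
          Real.rpow_mul (by norm_num), Real.rpow_logb (by norm_num) (by norm_num) hθ0]
      rw [h]
      nth_rewrite 2 [← Real.rpow_one θ]
      rw [← Real.rpow_add hθ0]
      exact Real.rpow_lt_one hθ0.le hθ1 (by norm_num)
  -- Chosen so that `(s^c)^(-1/(p-1)) = s^(-b)` in the dual factor of Hölder.
  set c := b * (p - 1) with hcdef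
  have hc : 0 < c := by positivity
  set B : ℝ≥0∞ := ENNReal.ofReal (2 ^ b) * (1 - ENNReal.ofReal (2 ^ b * θ))⁻¹
  have hB : B ≠ ∞ := by
    refine ENNReal.mul_ne_top ENNReal.ofReal_ne_top (ENNReal.inv_ne_top.2 ?_)
    exact (tsub_pos_of_lt (by simpa using hbθ)).ne'
  have hC : B ^ (p - 1) * A * ENNReal.ofReal (1 / c) ≠ ∞ :=
    ENNReal.mul_ne_top (ENNReal.mul_ne_top (ENNReal.rpow_ne_top_of_nonneg hp1.le hB)
      ENNReal.coe_ne_top) ENNReal.ofReal_ne_top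
  refine ⟨(B ^ (p - 1) * A * ENNReal.ofReal (1 / c)).toNNReal, fun w hw hA G hG => ?_⟩
  rw [ENNReal.coe_toNNReal hC]
  set H : ℝ → ℝ≥0∞ := fun s => G s ^ p * (ENNReal.ofReal (s ^ c) * w s) with hH
  have hHm : AEMeasurable H volume :=
    (hG.pow_const p).mul (AEMeasurable.mul (by fun_prop) hw.aemeasurable_coe)
  have hmain : ∀ t ∈ Ioi (0 : ℝ), ((∫⁻ s in Ioc 0 t⁻¹, (w s : ℝ≥0∞)) *
      (ENNReal.ofReal t * ∫⁻ s in Ioc 0 t⁻¹, G s) ^ p) * ENNReal.ofReal t⁻¹ ≤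
      B ^ (p - 1) * A * (ENNReal.ofReal (t ^ (c - 1)) * ∫⁻ s in Ioc 0 t⁻¹, H s) := by
    intro t ht
    rw [mem_Ioi] at ht
    have hr : 0 < t⁻¹ := inv_pos.2 ht
    have hHol := rpow_lintegral_le_weighted hp (ν := volume.restrict (Ioc 0 t⁻¹))
      (g := G) (m := fun s => ENNReal.ofReal (s ^ c) * w s) hG.restrict
      (AEMeasurable.mul (by fun_prop) hw.aemeasurable_coe).restrict
      (by
        filter_upwards [ae_restrict_of_ae hw.coe_ne_zero, ae_restrict_mem measurableSet_Ioc]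
          with s h1 h2
        refine mul_ne_zero ?_ h1
        simpa using Real.rpow_pos_of_pos h2.1 c)
      (Filter.Eventually.of_forall fun s =>
        ENNReal.mul_ne_top ENNReal.ofReal_ne_top ENNReal.coe_ne_top)
    have hdual : ∫⁻ s in Ioc 0 t⁻¹, (ENNReal.ofReal (s ^ c) * (w s : ℝ≥0∞)) ^ (-(1 / (p - 1))) =
        ∫⁻ s in Ioc 0 t⁻¹, ENNReal.ofReal (s ^ (-b)) * dualWeight p w s := by
      refine setLIntegral_congr_fun measurableSet_Ioc fun s hs => ?_
      rw [ENNReal.mul_rpow_of_ne_top ENNReal.ofReal_ne_top ENNReal.coe_ne_top,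
        ENNReal.ofReal_rpow_of_pos (Real.rpow_pos_of_pos hs.1 c), ← Real.rpow_mul hs.1.le]
      congr 3
      rw [hcdef]
      field_simp
    rw [hdual] at hHol
    have hdy := lintegral_rpow_mul_le hb.le (hθ w hw hA) hr
    have hAp := lintegral_mul_lintegral_dualWeight_le hp hA hr
    change _ ≤ (∫⁻ s in Ioc 0 t⁻¹, H s) * _ at hHol
    change _ ≤ B * _ * _ at hdy
    set S := ∫⁻ s in Ioc 0 t⁻¹, dualWeight p w s
    set W := ∫⁻ s in Ioc 0 t⁻¹, (w s : ℝ≥0∞)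
    set I := ∫⁻ s in Ioc 0 t⁻¹, H s
    have e1 : ENNReal.ofReal (t⁻¹ ^ (-b)) ^ (p - 1) = ENNReal.ofReal (t ^ c) := by
      rw [ENNReal.ofReal_rpow_of_pos (by positivity), Real.inv_rpow ht.le, Real.rpow_neg ht.le,
        inv_inv, ← Real.rpow_mul ht.le]
    have e2 : ENNReal.ofReal t⁻¹ ^ p * ENNReal.ofReal t ^ p = 1 := by
      rw [← ENNReal.mul_rpow_of_nonneg _ _ hp0.le, ← ENNReal.ofReal_mul hr.le,
        inv_mul_cancel₀ ht.ne']
      simp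
    have e3 : ENNReal.ofReal (t ^ c) * ENNReal.ofReal t⁻¹ = ENNReal.ofReal (t ^ (c - 1)) := by
      rw [← ENNReal.ofReal_mul (by positivity), Real.rpow_sub ht, Real.rpow_one, div_eq_mul_inv]
    rw [ENNReal.mul_rpow_of_nonneg _ _ hp0.le]
    calc _ ≤ W * (ENNReal.ofReal t ^ p *
          (I * (B * ENNReal.ofReal (t⁻¹ ^ (-b)) * S) ^ (p - 1))) * ENNReal.ofReal t⁻¹ := by
          gcongr
          exact hHol.trans (by gcongr)
      _ = (W * S ^ (p - 1)) * (ENNReal.ofReal t ^ p * I * B ^ (p - 1) *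
          (ENNReal.ofReal (t ^ c) * ENNReal.ofReal t⁻¹)) := by
          rw [ENNReal.mul_rpow_of_nonneg _ _ hp1.le, ENNReal.mul_rpow_of_nonneg _ _ hp1.le, e1]
          ring
      -- The `A_p` bound at `r = 1/t`; its factor `t^(-p)` cancels the `t^p` of the average.
      _ ≤ (A * ENNReal.ofReal t⁻¹ ^ p) * (ENNReal.ofReal t ^ p * I * B ^ (p - 1) *
          (ENNReal.ofReal (t ^ c) * ENNReal.ofReal t⁻¹)) := by gcongr
      _ = (ENNReal.ofReal t⁻¹ ^ p * ENNReal.ofReal t ^ p) * (B ^ (p - 1) * A *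
          (ENNReal.ofReal (t ^ (c - 1)) * I)) := by rw [e3]; ring
      _ = _ := by rw [e2, one_mul]
  have hBA : B ^ (p - 1) * A ≠ ∞ := ENNReal.mul_ne_top
    (ENNReal.rpow_ne_top_of_nonneg hp1.le hB) ENNReal.coe_ne_top
  refine (setLIntegral_mono' measurableSet_Ioi hmain).trans (le_of_eq ?_)
  rw [lintegral_const_mul' _ _ hBA, lintegral_rpow_mul_lintegral_Ioc_inv hc hHm, mul_assoc _
    (ENNReal.ofReal (1 / c)), ← lintegral_const_mul' _ _ ENNReal.ofReal_ne_top]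
  congr 1
  refine setLIntegral_congr_fun measurableSet_Ioi fun s hs => ?_
  rw [mem_Ioi] at hs
  -- The power `s^(-c)` produced by Tonelli removes the auxiliary `s^c` in `H`.
  have e : ENNReal.ofReal (s⁻¹ ^ c / c) * ENNReal.ofReal (s ^ c) = ENNReal.ofReal (1 / c) := by
    rw [← ENNReal.ofReal_mul (by positivity), Real.inv_rpow hs.le]
    congr 1
    field_simp
  simp only [hH]
  rw [← e]
  ring

/-! ### Averaged bound for the `K`-functional. -/

/-- Integrate the pointwise bound over `(0, r)` and divide by `r`. The constant `d` is the
measurable summand, so `h` may be arbitrary. -/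
theorem le_average_add {κ d : ℝ≥0∞} {h : ℝ → ℝ≥0∞} {r : ℝ} (hr : 0 < r)
    (hκ : ∀ τ ∈ Ioo 0 r, κ ≤ h τ + d) :
    κ ≤ ENNReal.ofReal r⁻¹ * (∫⁻ τ in Ioo 0 r, h τ) + d := by
  have h1 := setLIntegral_mono' (μ := volume) measurableSet_Ioo hκ
  rw [lintegral_add_right _ measurable_const, setLIntegral_const, setLIntegral_const,
    Real.volume_Ioo, sub_zero] at h1
  have e : ENNReal.ofReal r⁻¹ * ENNReal.ofReal r = 1 := by
    rw [← ENNReal.ofReal_mul (by positivity), inv_mul_cancel₀ hr.ne', ENNReal.ofReal_one]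
  calc κ = (ENNReal.ofReal r⁻¹ * ENNReal.ofReal r) * κ := by rw [e, one_mul]
    _ = ENNReal.ofReal r⁻¹ * (κ * ENNReal.ofReal r) := by ring
    _ ≤ ENNReal.ofReal r⁻¹ * ((∫⁻ τ in Ioo 0 r, h τ) + d * ENNReal.ofReal r) := by gcongr
    _ = ENNReal.ofReal r⁻¹ * (∫⁻ τ in Ioo 0 r, h τ) +
        (ENNReal.ofReal r⁻¹ * ENNReal.ofReal r) * d := by ring
    _ = _ := by rw [e, one_mul]

/-- An inequality suffices and avoids integrability: without it the Bochner integral is `0`. -/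
theorem ofReal_primitive_le (w : ℝ → ℝ≥0) {r : ℝ} (hr : 0 ≤ r) :
    ENNReal.ofReal (primitive w r) ≤ ∫⁻ s in Ioc 0 r, (w s : ℝ≥0∞) := by
  rw [primitive, intervalIntegral.integral_of_le hr]
  have h0 : 0 ≤ ∫ s in Ioc 0 r, (w s : ℝ) := integral_nonneg fun s => (w s).2
  rw [← Real.enorm_of_nonneg h0]
  refine (enorm_integral_le_lintegral_enorm _).trans (le_of_eq ?_)
  simp [Real.enorm_of_nonneg]

theorem primitive_nonneg (w : ℝ → ℝ≥0) {r : ℝ} (hr : 0 ≤ r) : 0 ≤ primitive w r := by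
  rw [primitive, intervalIntegral.integral_of_le hr]
  exact integral_nonneg fun s => (w s).2

namespace InterpolationCouple

variable {X₀ X₁ Z : Type*}
  [NormedAddCommGroup X₀] [NormedSpace ℝ X₀] [CompleteSpace X₀]
  [NormedAddCommGroup X₁] [NormedSpace ℝ X₁] [CompleteSpace X₁]
  [AddCommGroup Z] [Module ℝ Z] [TopologicalSpace Z] [IsTopologicalAddGroup Z]
  [ContinuousSMul ℝ Z] [T2Space Z]

theorem K_le (c : InterpolationCouple X₀ X₁ Z) (t : ℝ) {a : Z} (a₀ : X₀) (a₁ : X₁)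
    (h : a = c.incl₀ a₀ + c.incl₁ a₁) : c.K t a ≤ ‖a₀‖ₑ + ENNReal.ofReal t * ‖a₁‖ₑ :=
  iInf_le_of_le a₀ (iInf_le_of_le a₁ (iInf_le_of_le h le_rfl))

/-- The `K`-functional of an initial value is dominated by an average of the data. -/
theorem K_initial_value_le (c : InterpolationCouple X₀ X₁ Z) {N T : ℝ} (hT : 0 < T)
    (hN : 0 ≤ N) (hc : c.EmbedsWith N) {u : ℝ → X₀} {f : ℝ → X₁} {u₀ : Z}
    (hu : ∀ t ∈ Ioo 0 T, c.incl₀ (u t) = u₀ + c.incl₁ (∫ s in (0 : ℝ)..t, f s))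
    {t : ℝ} (ht : 0 < t) :
    c.K t u₀ ≤ ENNReal.ofReal t * ∫⁻ s in Ioc 0 t⁻¹,
      (Ioo 0 T).indicator (fun s => ENNReal.ofReal (max 1 (N / T)) * (‖u s‖ₑ + ‖f s‖ₑ)) s := by
  -- The entry `1` serves the case `1/t ≤ T`; `N / T` comes from the embedding and the average over
  -- `(0, T)` when `1/t ≥ T`.
  set M := ENNReal.ofReal (max 1 (N / T))
  have hM1 : 1 ≤ M := by
    rw [← ENNReal.ofReal_one]
    exact ENNReal.ofReal_le_ofReal (le_max_left _ _)
  have hMN : ENNReal.ofReal N * ENNReal.ofReal T⁻¹ ≤ M := by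
    rw [← ENNReal.ofReal_mul hN, ← div_eq_mul_inv]
    exact ENNReal.ofReal_le_ofReal (le_max_right _ _)
  have hr : 0 < t⁻¹ := inv_pos.2 ht
  have hF : ∀ τ R : ℝ, τ ∈ Ioo 0 R →
      ‖∫ s in (0 : ℝ)..τ, f s‖ₑ ≤ ∫⁻ s in Ioo 0 R, ‖f s‖ₑ := by
    intro τ R hτ
    rw [intervalIntegral.integral_of_le hτ.1.le]
    exact (enorm_integral_le_lintegral_enorm _).trans
      (lintegral_mono_set fun s hs => ⟨hs.1, hs.2.trans_lt hτ.2⟩)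
  have hG : ∀ R : ℝ, R ≤ t⁻¹ → R ≤ T →
      M * ((∫⁻ s in Ioo 0 R, ‖u s‖ₑ) + ∫⁻ s in Ioo 0 R, ‖f s‖ₑ) ≤
      ∫⁻ s in Ioc 0 t⁻¹, (Ioo 0 T).indicator (fun s => M * (‖u s‖ₑ + ‖f s‖ₑ)) s := by
    intro R h1 h2
    calc _ ≤ M * ∫⁻ s in Ioo 0 R, (‖u s‖ₑ + ‖f s‖ₑ) := by
          gcongr
          exact le_lintegral_add _ _
      _ = ∫⁻ s in Ioo 0 R, M * (‖u s‖ₑ + ‖f s‖ₑ) :=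
          (lintegral_const_mul' _ _ ENNReal.ofReal_ne_top).symm
      _ = ∫⁻ s in Ioo 0 R, (Ioo 0 T).indicator (fun s => M * (‖u s‖ₑ + ‖f s‖ₑ)) s := by
          refine setLIntegral_congr_fun measurableSet_Ioo fun s hs => ?_
          rw [indicator_of_mem (show s ∈ Ioo 0 T from ⟨hs.1, hs.2.trans_le h2⟩)]
      _ ≤ _ := lintegral_mono_set (Ioo_subset_Ioc_self.trans (Ioc_subset_Ioc_right h1))
  rcases le_total t⁻¹ T with h | h
  · have hK : ∀ τ ∈ Ioo 0 t⁻¹, c.K t u₀ ≤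
        ‖u τ‖ₑ + ENNReal.ofReal t * ∫⁻ s in Ioo 0 t⁻¹, ‖f s‖ₑ := by
      intro τ hτ
      refine (c.K_le t (u τ) (-∫ s in (0 : ℝ)..τ, f s) ?_).trans ?_
      · rw [map_neg, hu τ ⟨hτ.1, hτ.2.trans_le h⟩]
        abel
      · rw [enorm_neg]
        gcongr
        exact hF τ _ hτ
    have h2 := le_average_add hr hK
    rw [inv_inv, ← mul_add] at h2
    refine h2.trans ?_
    gcongr
    exact (le_mul_of_one_le_left zero_le hM1).trans (hG _ le_rfl h)
  -- Here `u` is unavailable on all of `(0, 1/t)`. Taking `a₀ = 0` gains the factor `t` on `u`,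
  -- which replaces the missing `1/r = t`.
  · have hK : ∀ τ ∈ Ioo 0 T, c.K t u₀ ≤ ENNReal.ofReal t * (ENNReal.ofReal N * ‖u τ‖ₑ) +
        ENNReal.ofReal t * ∫⁻ s in Ioo 0 T, ‖f s‖ₑ := by
      intro τ hτ
      obtain ⟨b, hb, hbN⟩ := hc (u τ)
      refine (c.K_le t 0 (b - ∫ s in (0 : ℝ)..τ, f s) ?_).trans ?_
      · rw [map_sub, hb, hu τ hτ]
        simp
      · rw [enorm_zero, zero_add, ← mul_add]
        gcongr
        refine (enorm_sub_le).trans (add_le_add ?_ (hF τ _ hτ))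
        rw [← ofReal_norm, ← ofReal_norm, ← ENNReal.ofReal_mul hN]
        exact ENNReal.ofReal_le_ofReal hbN
    have h2 := le_average_add hT hK
    rw [lintegral_const_mul' _ _ ENNReal.ofReal_ne_top,
      lintegral_const_mul' _ _ ENNReal.ofReal_ne_top] at h2
    refine h2.trans ?_
    calc _ = ENNReal.ofReal t * ((ENNReal.ofReal N * ENNReal.ofReal T⁻¹) *
          (∫⁻ s in Ioo 0 T, ‖u s‖ₑ) + 1 * ∫⁻ s in Ioo 0 T, ‖f s‖ₑ) := by ring
      _ ≤ ENNReal.ofReal t * (M * (∫⁻ s in Ioo 0 T, ‖u s‖ₑ) +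
          M * ∫⁻ s in Ioo 0 T, ‖f s‖ₑ) := by gcongr
      _ ≤ _ := by
          rw [← mul_add]
          gcongr
          exact hG _ h le_rfl

end InterpolationCouple

/-! ### Passage to the weighted measure and the main estimate. -/

/-- Transfers measurability of `u` and `f` from `w dt` back to Lebesgue measure on `(0, T)`, as the
Hardy inequality requires. -/
theorem IsApWeight.absolutelyContinuous {p : ℝ} {w : ℝ → ℝ≥0} (hw : IsApWeight p w) (T : ℝ) :
    volume.restrict (Ioo 0 T) ≪ weightMeasure T w :=
  withDensity_absolutelyContinuous' hw.aemeasurable_coe.restrict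
    (ae_restrict_of_ae hw.coe_ne_zero)

theorem lintegral_indicator_rpow_mul {p : ℝ} (hp : 0 < p) {w : ℝ → ℝ≥0} (hw : IsApWeight p w)
    (T : ℝ) {g : ℝ → ℝ≥0∞} (hg : AEMeasurable g (volume.restrict (Ioo 0 T))) :
    ∫⁻ s in Ioi (0 : ℝ), (Ioo 0 T).indicator g s ^ p * w s =
      ∫⁻ s, g s ^ p ∂(weightMeasure T w) := by
  rw [weightMeasure, lintegral_withDensity_eq_lintegral_mul₀ hw.aemeasurable_coe.restrict
    (hg.pow_const p), ← lintegral_indicator measurableSet_Ioi,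
    ← lintegral_indicator measurableSet_Ioo]
  refine lintegral_congr fun s => ?_
  by_cases h : s ∈ Ioo 0 T
  · simp [h, h.1, mul_comm]
  · simp [h, hp]

theorem eLpNorm_ofReal_eq {p : ℝ} (hp : 0 < p) {E : Type*} [NormedAddCommGroup E]
    {μ : Measure ℝ} (v : ℝ → E) :
    eLpNorm v (ENNReal.ofReal p) μ = (∫⁻ s, ‖v s‖ₑ ^ p ∂μ) ^ (1 / p) := by
  rw [eLpNorm_eq_lintegral_rpow_enorm_toReal (by simpa using hp) ENNReal.ofReal_ne_top,
    ENNReal.toReal_ofReal hp.le]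

end WeightedTrace

open WeightedTrace

theorem corollary5p1 (p T N : ℝ) (A : ℝ≥0) (hp : 1 < p) (hT : 0 < T) (hN : 0 < N) :
    ∃ C : ℝ≥0,
      ∀ (X₀ X₁ Z : Type*)
        [NormedAddCommGroup X₀] [NormedSpace ℝ X₀] [CompleteSpace X₀]
        [NormedAddCommGroup X₁] [NormedSpace ℝ X₁] [CompleteSpace X₁]
        [AddCommGroup Z] [Module ℝ Z] [TopologicalSpace Z] [IsTopologicalAddGroup Z]
        [ContinuousSMul ℝ Z] [T2Space Z]
        (c : WeightedTrace.InterpolationCouple X₀ X₁ Z) (_ : c.EmbedsWith N)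
        (w : ℝ → ℝ≥0) (_ : WeightedTrace.IsApWeight p w) (_ : WeightedTrace.apConst p w ≤ A)
        (u : ℝ → X₀) (f : ℝ → X₁) (u₀ : Z)
        (_ : MemLp u (ENNReal.ofReal p) (WeightedTrace.weightMeasure T w))
        (_ : MemLp f (ENNReal.ofReal p) (WeightedTrace.weightMeasure T w))
        (_ : u₀ ∈ c.sumSpace)
        (_ : ∀ t ∈ Ioo 0 T, c.incl₀ (u t) = u₀ + c.incl₁ (∫ s in (0 : ℝ)..t, f s)),
        u₀ ∈ c.interpSpace (fun t => WeightedTrace.primitive w t ^ (1 / p)) p ∧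
          c.interpNorm (fun t => WeightedTrace.primitive w t ^ (1 / p)) p u₀ ≤
            C * (eLpNorm u (ENNReal.ofReal p) (WeightedTrace.weightMeasure T w) +
              eLpNorm f (ENNReal.ofReal p) (WeightedTrace.weightMeasure T w)) := by
  have hp0 : 0 < p := by linarith
  obtain ⟨C, hC⟩ := exists_hardy_le hp A
  set M := max 1 (N / T)
  refine ⟨C ^ (1 / p) * M.toNNReal, ?_⟩
  intro X₀ X₁ Z _ _ _ _ _ _ _ _ _ _ _ _ c hc w hw hA u f u₀ hu hf hu₀ heq
  suffices hle : c.interpNorm (fun t => primitive w t ^ (1 / p)) p u₀ ≤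
      ((C ^ (1 / p) * M.toNNReal : ℝ≥0) : ℝ≥0∞) *
        (eLpNorm u (ENNReal.ofReal p) (weightMeasure T w) +
          eLpNorm f (ENNReal.ofReal p) (weightMeasure T w)) from
    ⟨⟨hu₀, hle.trans_lt (ENNReal.mul_lt_top ENNReal.coe_lt_top
      (ENNReal.add_lt_top.2 ⟨hu.2, hf.2⟩))⟩, hle⟩
  have hum : AEMeasurable (fun s => ‖u s‖ₑ) (weightMeasure T w) := hu.1.enorm
  have hfm : AEMeasurable (fun s => ‖f s‖ₑ) (weightMeasure T w) := hf.1.enorm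
  have hgm : AEMeasurable (fun s => ENNReal.ofReal M * (‖u s‖ₑ + ‖f s‖ₑ))
      (volume.restrict (Ioo 0 T)) :=
    ((hum.add hfm).const_mul _).mono_ac (hw.absolutelyContinuous T)
  -- Hardy is applied to the data extended by zero outside `(0, T)`.
  have hhardy := hC w hw hA _ ((aemeasurable_indicator_iff measurableSet_Ioo).2 hgm)
  rw [lintegral_indicator_rpow_mul hp0 hw T hgm] at hhardy
  have hpow : (∫⁻ t in Ioi (0 : ℝ), (ENNReal.ofReal (primitive w t⁻¹ ^ (1 / p)) *
      c.K t u₀) ^ p * ENNReal.ofReal t⁻¹) ≤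
      C * ∫⁻ s, (ENNReal.ofReal M * (‖u s‖ₑ + ‖f s‖ₑ)) ^ p ∂(weightMeasure T w) := by
    refine (setLIntegral_mono' measurableSet_Ioi fun t ht => ?_).trans hhardy
    rw [mem_Ioi] at ht
    have hr : 0 ≤ t⁻¹ := inv_nonneg.2 ht.le
    rw [ENNReal.mul_rpow_of_nonneg _ _ hp0.le, ENNReal.ofReal_rpow_of_nonneg
      (Real.rpow_nonneg (primitive_nonneg w hr) _) hp0.le, ← Real.rpow_mul
      (primitive_nonneg w hr), one_div_mul_cancel hp0.ne', Real.rpow_one]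
    gcongr
    · exact ofReal_primitive_le w hr
    · exact c.K_initial_value_le hT hN.le hc heq ht
  have hMink := ENNReal.lintegral_Lp_add_le hum hfm hp.le
  calc c.interpNorm (fun t => primitive w t ^ (1 / p)) p u₀
      ≤ (C * ∫⁻ s, (ENNReal.ofReal M * (‖u s‖ₑ + ‖f s‖ₑ)) ^ p ∂(weightMeasure T w)) ^ (1 / p) :=
        ENNReal.rpow_le_rpow hpow (by positivity)
    _ = (C : ℝ≥0∞) ^ (1 / p) * ENNReal.ofReal M *
        (∫⁻ s, (‖u s‖ₑ + ‖f s‖ₑ) ^ p ∂(weightMeasure T w)) ^ (1 / p) := by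
        simp only [ENNReal.mul_rpow_of_nonneg _ _ hp0.le]
        rw [lintegral_const_mul' _ _
          (ENNReal.rpow_ne_top_of_nonneg hp0.le ENNReal.ofReal_ne_top),
          ENNReal.mul_rpow_of_nonneg _ _ (by positivity),
          ENNReal.mul_rpow_of_nonneg _ _ (by positivity), ← ENNReal.rpow_mul,
          mul_one_div_cancel hp0.ne', ENNReal.rpow_one, mul_assoc]
    _ ≤ (C : ℝ≥0∞) ^ (1 / p) * ENNReal.ofReal M *
        (eLpNorm u (ENNReal.ofReal p) (weightMeasure T w) +
          eLpNorm f (ENNReal.ofReal p) (weightMeasure T w)) := by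
        rw [eLpNorm_ofReal_eq hp0, eLpNorm_ofReal_eq hp0]
        gcongr
        exact hMink
    _ = _ := by
        rw [ENNReal.coe_mul, ← ENNReal.coe_rpow_of_nonneg _ (by positivity), ENNReal.ofReal]
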